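/- Let $d\in\mathbb N$ and let $W=\{W(t)\}_{t\in\mathbb R^d}$ be a path-continuous, centred, real Gaussian random field which is intrinsically stationary, i.e. for every $h\in\mathbb R^d$ the field $x\mapsto W(x+h)-W(x)$ is weakly stationary. Let $\gamma(h)=\tfrac12\,\mathbb E\,(W(h)-W(0))^2$ be its variogram and $\sigma^2(t)=\operatorname{Var}(W(t))$. Let $W_1,W_2,\dots$ be path-continuous i.i.d. copies of $W$, and let $X_1,X_2,\dots$ be real random variables such that $\sum_{i}\delta_{X_i}$ is a Poisson point process on $\mathbb R$ with intensity measure $e^{-x}\,dx$, the sequence $(X_i)_{i}$ being independent of the sequence $(W_i)_{i}$. Put $$Z(t)=\max_{i\in\mathbb N}\Bigl(X_i+W_i(t)-\frac{\sigma^2(t)}2\Bigr),\qquad t\in\mathbb R^d .$$ Then, almost surely, the maximum is attained for all $t\in\mathbb R^d$ simultaneously, and $Z$ is a random field on $\mathbb R^d$ with the following properties. 1. $Z$ is strictly stationary: its finite-dimensional distributions are translation invariant. 2. $Z$ has standard Gumbel margins: $\mathbb P(Z(t)\le x)=\exp(-e^{-x})$ for all $t\in\mathbb R^d$, $x\in\mathbb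 R$. 3. $Z$ is max-stable: for every $n\ge 1$ and i.i.d. copies $Z_1,\dots,Z_n$ of $Z$, the field $\max_{1\le l\le n}Z_l(\cdot)-\log n$ has the same finite-dimensional distributions as $Z$. 4. The law of $Z$ depends only on $\gamma$: if $W'$, $(W_i')$, $(X_i')$ (possibly on other probability spaces) satisfy the same assumptions and $W'$ has the same variogram $\gamma$, then the resulting field $Z'$ has the same finite-dimensional distributions as $Z$. -/

import Mathlib

open MeasureTheory ProbabilityTheory
open scoped ENNReal NNReal

namespace BrownResnick

universe u v

/-- The space `ℝ^d`. -/
abbrev Space (d : ℕ) : Type := EuclideanSpace ℝ (Fin d)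

section Fields

variable {d : ℕ} {Ω : Type u} [MeasurableSpace Ω]

/-- A real random field on `ℝ^d`: a family of real random variables indexed by `ℝ^d`. -/
def IsRandomField (Z : Space d → Ω → ℝ) : Prop :=
  ∀ t, Measurable (Z t)

/-- The sample path of a field, as a function of the outcome. The space of all functions
`Space d → ℝ` carries the product σ-algebra, so that the law of `path Z` is the law of the field,
i.e. the collection of its finite-dimensional distributions. -/
def path (Z : Space d → Ω → ℝ) : Ω → (Space d → ℝ) :=
  fun ω t => Z t ω

/-- Strict stationarity: all finite-dimensional distributions are translation invariant. -/
def IsStationary (Z : Space d → Ω → ℝ) (P : Measure Ω) : Prop :=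
  ∀ (n : ℕ) (x : Fin n → Space d) (h : Space d) (B : Fin n → Set ℝ),
    (∀ k, MeasurableSet (B k)) →
      P {ω | ∀ k, Z (x k + h) ω ∈ B k} = P {ω | ∀ k, Z (x k) ω ∈ B k}

/-- Weak stationarity: a square-integrable field whose mean at `t` and whose covariance
`Cov (Y (x + t), Y t)`, for every `x`, do not depend on `t`. -/
structure IsWeaklyStationary (Y : Space d → Ω → ℝ) (P : Measure Ω) : Prop where
  memLp_two : ∀ t, MemLp (Y t) 2 P
  mean_eq : ∀ s t, ∫ ω, Y s ω ∂P = ∫ ω, Y t ω ∂P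
  cov_eq : ∀ x s t, covariance (Y (x + s)) (Y s) P = covariance (Y (x + t)) (Y t) P

/-- Intrinsic stationarity: for each `h` the increment field `x ↦ W (x + h) - W x` is weakly
stationary. -/
def IsIntrinsicallyStationary (W : Space d → Ω → ℝ) (P : Measure Ω) : Prop :=
  ∀ h : Space d, IsWeaklyStationary (fun x ω => W (x + h) ω - W x ω) P

/-- The (semi-)variogram `γ(h) = 1/2 E (W(h) - W(0))^2`. -/
noncomputable def variogram (W : Space d → Ω → ℝ) (P : Measure Ω) (h : Space d) : ℝ :=
  (1 / 2 : ℝ) * ∫ ω, (W h ω - W 0 ω) ^ 2 ∂P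

/-- Standard Gumbel margins: `P (Z(t) ≤ x) = exp (-exp (-x))`. -/
def HasStandardGumbelMargins (Z : Space d → Ω → ℝ) (P : Measure Ω) : Prop :=
  ∀ (t : Space d) (x : ℝ),
    P {ω | Z t ω ≤ x} = ENNReal.ofReal (Real.exp (-Real.exp (-x)))

/-- Max-stability of a field with standard Gumbel margins: for all `n ≥ 1` and all i.i.d. copies
`Z₁, …, Zₙ` of `Z`, on any probability space, `max (Z₁, …, Zₙ) - log n` has the same law as
`Z`. -/
def IsMaxStable (Z : Space d → Ω → ℝ) (P : Measure Ω) : Prop :=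
  HasStandardGumbelMargins Z P ∧
    ∀ (Ω' : Type v) [MeasurableSpace Ω'] (P' : Measure Ω') [IsProbabilityMeasure P']
      (n : ℕ) (Zc : Fin n → Space d → Ω' → ℝ), 1 ≤ n →
      (∀ l, IdentDistrib (path (Zc l)) (path Z) P' P) →
      iIndepFun (fun l => path (Zc l)) P' →
        IdentDistrib (path fun t ω => (⨆ l, Zc l t ω) - Real.log n) (path Z) P' P

end Fields

section PointProcesses

variable {Ω : Type u} [MeasurableSpace Ω] {S : Type v} [MeasurableSpace S]

/-- `N` is a Poisson point process with intensity measure `μ`: a random counting measure whose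
values on disjoint measurable sets are independent, and whose value on a measurable set `A` is
Poisson distributed with parameter `μ A`, i.e. almost surely infinite when `μ A = ∞`. -/
structure IsPoissonPointProcess (N : Ω → Measure S) (μ : Measure S) (P : Measure Ω) : Prop where
  measurable : Measurable N
  counting : ∀ ω A, MeasurableSet A → ∃ n : ℕ∞, N ω A = (n : ℝ≥0∞)
  indep : ∀ (n : ℕ) (A : Fin n → Set S), (∀ k, MeasurableSet (A k)) →
    (Pairwise fun j k => Disjoint (A j) (A k)) → iIndepFun (fun k ω => N ω (A k)) P
  poisson : ∀ A, MeasurableSet A → μ A ≠ ∞ →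
    P.map (fun ω => N ω A) = (poissonMeasure (μ A).toNNReal).map (fun n : ℕ => (n : ℝ≥0∞))
  poisson_top : ∀ A, MeasurableSet A → μ A = ∞ → ∀ᵐ ω ∂P, N ω A = ∞

/-- The random counting measure `∑ i, δ_{X i}`. -/
noncomputable def pointMeasure (X : ℕ → Ω → S) (ω : Ω) : Measure S :=
  Measure.sum fun i => Measure.dirac (X i ω)

end PointProcesses

/-- The measure `e^{-x} dx` on `ℝ`. -/
noncomputable def expIntensity : Measure ℝ :=
  volume.withDensity fun x => ENNReal.ofReal (Real.exp (-x))

section Construction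

variable {d : ℕ} {Ω₀ : Type u} [MeasurableSpace Ω₀] {Ω : Type v} [MeasurableSpace Ω]

/-- A path-continuous, centred, intrinsically stationary Gaussian field on `ℝ^d` with
variogram `γ`. -/
structure IsDrivingField (W : Space d → Ω₀ → ℝ) (P₀ : Measure Ω₀) (γ : Space d → ℝ) :
    Prop where
  isRandomField : IsRandomField W
  continuous_paths : ∀ᵐ ω ∂P₀, Continuous (path W ω)
  gaussian : IsGaussianProcess W P₀
  centred : ∀ t, ∫ ω, W t ω ∂P₀ = 0
  intrinsicallyStationary : IsIntrinsicallyStationary W P₀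
  variogram_eq : ∀ h, variogram W P₀ h = γ h

/-- The path-continuous fields `Wc 0, Wc 1, …` are i.i.d. copies of `W`, and the points `X i`
form a Poisson point process on `ℝ` with intensity `e^{-x} dx`; the sequence of points is
independent of the sequence of fields. -/
structure IsMarkedPoissonSample (W : Space d → Ω₀ → ℝ) (P₀ : Measure Ω₀)
    (Wc : ℕ → Space d → Ω → ℝ) (X : ℕ → Ω → ℝ) (P : Measure Ω) : Prop where
  isRandomField : ∀ i, IsRandomField (Wc i)
  continuous_paths : ∀ i, ∀ᵐ ω ∂P, Continuous (path (Wc i) ω)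
  identDistrib : ∀ i, IdentDistrib (path (Wc i)) (path W) P P₀
  indep_copies : iIndepFun (fun i => path (Wc i)) P
  measurable_points : ∀ i, Measurable (X i)
  poisson : IsPoissonPointProcess (pointMeasure X) expIntensity P
  indep : IndepFun (fun ω i => X i ω) (fun ω i => path (Wc i) ω) P

/-- The `i`-th term `X_i + W_i(t) - σ²(t)/2`, where `σ²(t) = Var (W(t))`. -/
noncomputable def term (W : Space d → Ω₀ → ℝ) (P₀ : Measure Ω₀) (Wc : ℕ → Space d → Ω → ℝ)
    (X : ℕ → Ω → ℝ) (i : ℕ) (t : Space d) (ω : Ω) : ℝ :=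
  X i ω + Wc i t ω - variance (W t) P₀ / 2

/-- The field `Z(t) = max_i (X_i + W_i(t) - σ²(t)/2)`, written as a supremum. -/
noncomputable def maxField (W : Space d → Ω₀ → ℝ) (P₀ : Measure Ω₀) (Wc : ℕ → Space d → Ω → ℝ)
    (X : ℕ → Ω → ℝ) (t : Space d) (ω : Ω) : ℝ :=
  ⨆ i, term W P₀ Wc X i t ω

end Construction

end BrownResnick

/-! Write `ξ(t) = W(t) - σ²(t)/2`. For finitely many locations, `Z(x k) ≤ y k` for all `k` means
that no Poisson point `X i` with mark `V i = max_k exp (ξ_i(x k) - y k)` satisfies `exp (X i) * V i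
> 1`. Conditionally on the points, the marks are independent, so the probability of this event is
the mean of a product over the points, which the Laplace functional of the Poisson process
evaluates. Because the intensity is `e^{-x} dx`, the expected number of exceedances is exactly `E
V`. Hence the joint distribution functions of `Z` are `exp (-E max_k exp (ξ(x k) - y k))`
(`measure_forall_maxField_le`), and everything is read off from this exponent.

The exponent depends only on the values `γ(x i - x j)` (`exponent_eq`). Factoring out `exp (ξ(x k))`
for one index `k` leaves a functional of the increments of `ξ` under the measure tilted by `exp (ξ(x
k))`. The moment generating function of this tilted law consists of moments `E exp (∑ a i * ξ(x i))`
with `∑ a i = 1`, and for such weights the drift cancels every variance in the Gaussian exponent.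
Stationarity follows since translations preserve differences, and so does dependence on `γ` alone.
Max-stability is homogeneity of the exponent in `exp (-y)`; the Gumbel margins come from `E exp
(ξ(t)) = 1`.

Attainment of the maximum uses the same counting with the mark `c * sup exp W` over a ball:
Fernique's theorem makes its mean finite, so only finitely many terms compete. -/

namespace BrownResnick

open Filter Topology

/-! ### The exponential of the negative on `[0, ∞]` -/

section ExpNeg

/-- The function `x ↦ exp (-x)` on `[0, ∞]`. -/
noncomputable def expNeg (x : ℝ≥0∞) : ℝ≥0∞ := EReal.exp (-(x : EReal))

lemma expNeg_zero : expNeg 0 = 1 := by simp [expNeg]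

lemma expNeg_top : expNeg ∞ = 0 := by simp [expNeg]

lemma expNeg_ofReal {x : ℝ} (hx : 0 ≤ x) :
    expNeg (ENNReal.ofReal x) = ENNReal.ofReal (Real.exp (-x)) := by
  rw [expNeg, EReal.coe_ennreal_ofReal, max_eq_left hx, ← EReal.coe_neg, EReal.exp_coe]

lemma expNeg_add (x y : ℝ≥0∞) : expNeg (x + y) = expNeg x * expNeg y := by
  rw [expNeg, EReal.coe_ennreal_add, EReal.neg_add, sub_eq_add_neg, EReal.exp_add]
  · rfl
  · exact Or.inl (EReal.coe_ennreal_ne_bot x)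
  · exact Or.inr (EReal.coe_ennreal_ne_bot y)

lemma expNeg_sum {ι : Type*} (s : Finset ι) (f : ι → ℝ≥0∞) :
    expNeg (∑ i ∈ s, f i) = ∏ i ∈ s, expNeg (f i) := by
  classical
  induction s using Finset.induction_on with
  | empty => simp [expNeg_zero]
  | insert i s hi ih => rw [Finset.sum_insert hi, Finset.prod_insert hi, expNeg_add, ih]

lemma expNeg_nsmul (n : ℕ) (x : ℝ≥0∞) : expNeg (n * x) = expNeg x ^ n := by
  have := expNeg_sum (Finset.range n) fun _ => x
  simpa using this

lemma continuous_expNeg : Continuous expNeg :=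
  ENNReal.continuous_exp.comp (continuous_neg.comp continuous_coe_ennreal_ereal)

lemma measurable_expNeg : Measurable expNeg := continuous_expNeg.measurable

lemma antitone_expNeg : Antitone expNeg := fun _ _ h =>
  EReal.exp_monotone (EReal.neg_le_neg_iff.2 (EReal.coe_ennreal_le_coe_ennreal_iff.2 h))

lemma expNeg_le_one (x : ℝ≥0∞) : expNeg x ≤ 1 :=
  expNeg_zero ▸ antitone_expNeg zero_le

lemma expNeg_lt_one {x : ℝ≥0∞} (hx : x ≠ 0) : expNeg x < 1 := by
  rw [expNeg, EReal.exp_lt_one_iff, EReal.neg_lt_comm, neg_zero]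
  exact EReal.coe_ennreal_pos.2 (pos_iff_ne_zero.2 hx)

/-- A measurable right inverse of `expNeg` on `[0, 1]`. -/
noncomputable def negLog (x : ℝ≥0∞) : ℝ≥0∞ := (-(ENNReal.log x)).toENNReal

lemma expNeg_negLog {x : ℝ≥0∞} (hx : x ≤ 1) : expNeg (negLog x) = x := by
  have h : 0 ≤ -(ENNReal.log x) := by
    rw [EReal.le_neg, neg_zero]
    simpa using ENNReal.log_monotone hx
  rw [expNeg, negLog, EReal.coe_toENNReal h, neg_neg, ENNReal.exp_log]

lemma measurable_negLog : Measurable negLog :=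
  measurable_ereal_toENNReal.comp (measurable_neg.comp ENNReal.measurable_log)

end ExpNeg

/-! ### Campbell's formula and the Laplace functional of a Poisson process -/

section Poisson

lemma lintegral_poissonMeasure (r : ℝ≥0) (f : ℕ → ℝ≥0∞) :
    ∫⁻ n, f n ∂(poissonMeasure r) =
      ∑' n, ENNReal.ofReal (Real.exp (-r) * r ^ n / n.factorial) * f n := by
  rw [lintegral_countable']
  exact tsum_congr fun n => by rw [poissonMeasure_singleton, mul_comm]

/-- With `q = exp (-c)` the integrand is `q ^ n`, so this is the exponential series. The case `c =
∞` is included, with `q = 0`, `∞ * 0 = 0` and `0 ^ 0 = 1`. -/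
lemma lintegral_expNeg_poissonMeasure (r : ℝ≥0) (c : ℝ≥0∞) :
    ∫⁻ n : ℕ, expNeg (c * n) ∂(poissonMeasure r) = expNeg ((1 - expNeg c) * r) := by
  obtain ⟨q, hq⟩ : ∃ q : ℝ≥0, expNeg c = q :=
    ⟨_, (ENNReal.coe_toNNReal ((expNeg_le_one c).trans_lt ENNReal.one_lt_top).ne).symm⟩
  have hq1 : (q : ℝ) ≤ 1 := by exact_mod_cast hq ▸ expNeg_le_one c
  have hR : (1 - expNeg c) * r = ENNReal.ofReal ((1 - q) * r) := by
    rw [hq, ENNReal.ofReal_mul (by linarith), ENNReal.ofReal_sub _ q.coe_nonneg]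
    simp
  rw [hR, expNeg_ofReal (mul_nonneg (by linarith) r.coe_nonneg), lintegral_poissonMeasure]
  have h1 : ∀ n : ℕ, ENNReal.ofReal (Real.exp (-r) * r ^ n / n.factorial) * expNeg (c * n) =
      ENNReal.ofReal (Real.exp (-r) * ((r * q) ^ n / n.factorial)) := fun n => by
    rw [mul_comm c, expNeg_nsmul, hq, ← ENNReal.ofReal_coe_nnreal, ← ENNReal.ofReal_pow q.coe_nonneg,
      ← ENNReal.ofReal_mul (by positivity)]
    congr 1
    rw [mul_pow]
    ring
  simp_rw [h1]
  have hs := (NormedSpace.expSeries_div_hasSum_exp (𝔸 := ℝ) ((r : ℝ) * q)).mul_left (Real.exp (-r))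
  rw [← ENNReal.ofReal_tsum_of_nonneg (fun n => by positivity) hs.summable, hs.tsum_eq,
    ← Real.exp_eq_exp_ℝ, ← Real.exp_add]
  congr 2
  ring

lemma lintegral_natCast_poissonMeasure (r : ℝ≥0) :
    ∫⁻ n : ℕ, (n : ℝ≥0∞) ∂(poissonMeasure r) = r := by
  rw [lintegral_poissonMeasure, tsum_eq_zero_add' ENNReal.summable]
  have h1 : ∀ n : ℕ, ENNReal.ofReal (Real.exp (-r) * r ^ (n + 1) / (n + 1).factorial) *
      ((n + 1 : ℕ) : ℝ≥0∞) = r * ENNReal.ofReal (Real.exp (-r) * r ^ n / n.factorial) := fun n => by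
    rw [← ENNReal.ofReal_natCast, ← ENNReal.ofReal_mul (by positivity),
      ← ENNReal.ofReal_coe_nnreal, ← ENNReal.ofReal_mul r.coe_nonneg, Nat.factorial_succ]
    congr 1
    push_cast
    field_simp
    ring
  simp_rw [h1]
  rw [ENNReal.tsum_mul_left]
  have := lintegral_poissonMeasure r 1
  simp only [Pi.one_apply, lintegral_one, measure_univ, mul_one] at this
  rw [← this]
  simp

variable {Ω : Type*} [MeasurableSpace Ω] {P : Measure Ω}
  {S : Type*} [MeasurableSpace S] {μ : Measure S} {N : Ω → Measure S}

namespace IsPoissonPointProcess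

lemma measurable_apply (hN : IsPoissonPointProcess N μ P) {A : Set S} (hA : MeasurableSet A) :
    Measurable fun ω => N ω A :=
  (Measure.measurable_coe hA).comp hN.measurable

lemma lintegral_comp_apply (hN : IsPoissonPointProcess N μ P) {A : Set S} (hA : MeasurableSet A)
    (hμ : μ A ≠ ∞) {g : ℝ≥0∞ → ℝ≥0∞} (hg : Measurable g) :
    ∫⁻ ω, g (N ω A) ∂P = ∫⁻ n : ℕ, g n ∂(poissonMeasure (μ A).toNNReal) := by
  rw [← lintegral_map hg (hN.measurable_apply hA), hN.poisson A hA hμ,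
    lintegral_map hg measurable_from_top]

lemma lintegral_apply [IsProbabilityMeasure P] (hN : IsPoissonPointProcess N μ P) {A : Set S} (hA : MeasurableSet A) :
    ∫⁻ ω, N ω A ∂P = μ A := by
  by_cases hμ : μ A = ∞
  · rw [lintegral_congr_ae (hN.poisson_top A hA hμ), hμ]
    simp
  · rw [hN.lintegral_comp_apply (g := fun x => x) hA hμ measurable_id, ← ENNReal.coe_toNNReal hμ]
    exact lintegral_natCast_poissonMeasure _

/-- Campbell's formula. -/
lemma lintegral_lintegral [IsProbabilityMeasure P] (hN : IsPoissonPointProcess N μ P) {f : S → ℝ≥0∞} (hf : Measurable f) :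
    ∫⁻ ω, ∫⁻ x, f x ∂(N ω) ∂P = ∫⁻ x, f x ∂μ := by
  rw [← Measure.lintegral_bind hN.measurable.aemeasurable hf.aemeasurable]
  congr 1
  ext A hA
  rw [Measure.bind_apply hA hN.measurable.aemeasurable, hN.lintegral_apply hA]

lemma lintegral_expNeg_mul_apply [IsProbabilityMeasure P] (hN : IsPoissonPointProcess N μ P) {A : Set S}
    (hA : MeasurableSet A) (c : ℝ≥0∞) :
    ∫⁻ ω, expNeg (c * N ω A) ∂P = expNeg ((1 - expNeg c) * μ A) := by
  by_cases hμ : μ A = ∞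
  · by_cases hc : c = 0
    · simp [hc, expNeg_zero]
    · have h1 : (1 - expNeg c) * ∞ = ∞ :=
        ENNReal.mul_top (tsub_pos_of_lt (expNeg_lt_one hc)).ne'
      rw [hμ, h1, expNeg_top]
      have : ∀ᵐ ω ∂P, expNeg (c * N ω A) = 0 := by
        filter_upwards [hN.poisson_top A hA hμ] with ω hω
        rw [hω, ENNReal.mul_top hc, expNeg_top]
      rw [lintegral_congr_ae this, lintegral_zero]
  · have hm : Measurable fun x => expNeg (c * x) := measurable_expNeg.comp (measurable_const_mul c)
    rw [hN.lintegral_comp_apply hA hμ hm, lintegral_expNeg_poissonMeasure, ENNReal.coe_toNNReal hμ]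

/-- The level sets of `f` are disjoint, so their counts are independent and the expectation factors
into one-set Laplace transforms. -/
lemma lintegral_expNeg_simpleFunc [IsProbabilityMeasure P] (hN : IsPoissonPointProcess N μ P) (f : SimpleFunc S ℝ≥0∞) :
    ∫⁻ ω, expNeg (∫⁻ x, f x ∂(N ω)) ∂P = expNeg (∫⁻ x, (1 - expNeg (f x)) ∂μ) := by
  set e := f.range.equivFin.symm
  set A : Fin f.range.card → Set S := fun k => f ⁻¹' {(e k : ℝ≥0∞)}
  have hA : ∀ k, MeasurableSet (A k) := fun k => f.measurableSet_preimage _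
  have hdisj : Pairwise fun j k => Disjoint (A j) (A k) := fun j k hjk => by
    refine Set.disjoint_left.2 fun x hj hk => hjk (e.injective (Subtype.ext ?_))
    exact (show f x = e j from hj).symm.trans hk
  have hi := hN.indep _ A hA hdisj
  have hm : ∀ k, Measurable fun x => expNeg ((e k : ℝ≥0∞) * x) := fun k =>
    measurable_expNeg.comp (measurable_const_mul _)
  have key := lintegral_prod_eq_prod_lintegral_of_indepFun Finset.univ
    (fun k ω => expNeg ((e k : ℝ≥0∞) * N ω (A k)))
    (hi.comp (fun k x => expNeg ((e k : ℝ≥0∞) * x)) hm)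
    fun k => (hm k).comp (hN.measurable_apply (hA k))
  have hsum : ∀ (ν : Measure S) (g : ℝ≥0∞ → ℝ≥0∞), ∫⁻ x, g (f x) ∂ν = ∑ k, g (e k) * ν (A k) :=
    fun ν g => by
      have h1 := (f.map g).lintegral_eq_lintegral ν
      rw [SimpleFunc.map_lintegral] at h1
      rw [e.sum_comp (fun c : f.range => g c * ν (f ⁻¹' {(c : ℝ≥0∞)})),
        Finset.sum_coe_sort f.range fun c => g c * ν (f ⁻¹' {c}), ← h1]
      rfl
  calc ∫⁻ ω, expNeg (∫⁻ x, f x ∂(N ω)) ∂P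
      = ∫⁻ ω, ∏ k, expNeg ((e k : ℝ≥0∞) * N ω (A k)) ∂P := by
        refine lintegral_congr fun ω => ?_
        rw [hsum (N ω) fun c => c, expNeg_sum]
    _ = ∏ k, expNeg ((1 - expNeg (e k)) * μ (A k)) := by
        rw [key]
        exact Finset.prod_congr rfl fun k _ => hN.lintegral_expNeg_mul_apply (hA k) _
    _ = _ := by rw [hsum μ fun c => 1 - expNeg c, expNeg_sum]

/-- The Laplace functional of a Poisson point process. -/
theorem lintegral_expNeg_lintegral [IsProbabilityMeasure P] (hN : IsPoissonPointProcess N μ P) {f : S → ℝ≥0∞}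
    (hf : Measurable f) :
    ∫⁻ ω, expNeg (∫⁻ x, f x ∂(N ω)) ∂P = expNeg (∫⁻ x, (1 - expNeg (f x)) ∂μ) := by
  have hlim : ∀ x, Tendsto (fun n => SimpleFunc.eapprox f n x) atTop (𝓝 (f x)) := fun x => by
    rw [← SimpleFunc.iSup_eapprox_apply hf x]
    exact tendsto_atTop_iSup fun i j h => SimpleFunc.monotone_eapprox f h x
  have hmono : ∀ x, Monotone fun n => SimpleFunc.eapprox f n x := fun x i j h =>
    SimpleFunc.monotone_eapprox f h x
  have h1 : ∀ ν : Measure S, Tendsto (fun n => ∫⁻ x, SimpleFunc.eapprox f n x ∂ν) atTop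
      (𝓝 (∫⁻ x, f x ∂ν)) := fun ν =>
    lintegral_tendsto_of_tendsto_of_monotone (fun n => (SimpleFunc.measurable _).aemeasurable)
      (ae_of_all _ hmono) (ae_of_all _ hlim)
  have h2 : Tendsto (fun n => ∫⁻ x, (1 - expNeg (SimpleFunc.eapprox f n x)) ∂μ) atTop
      (𝓝 (∫⁻ x, (1 - expNeg (f x)) ∂μ)) := by
    refine lintegral_tendsto_of_tendsto_of_monotone
      (fun n => ((measurable_expNeg.comp (SimpleFunc.measurable _)).const_sub 1).aemeasurable)
      (ae_of_all _ fun x i j h => tsub_le_tsub_left (antitone_expNeg (hmono x h)) _)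
      (ae_of_all _ fun x => ?_)
    exact ENNReal.Tendsto.sub tendsto_const_nhds ((continuous_expNeg.tendsto _).comp (hlim x))
      (Or.inl ENNReal.one_ne_top)
  have h3 : Tendsto (fun n => ∫⁻ ω, expNeg (∫⁻ x, SimpleFunc.eapprox f n x ∂(N ω)) ∂P) atTop
      (𝓝 (∫⁻ ω, expNeg (∫⁻ x, f x ∂(N ω)) ∂P)) := by
    refine tendsto_lintegral_of_dominated_convergence (fun _ => 1) (fun n => ?_)
      (fun n => ae_of_all _ fun ω => expNeg_le_one _) (by simp)
      (ae_of_all _ fun ω => (continuous_expNeg.tendsto _).comp (h1 (N ω)))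
    exact measurable_expNeg.comp
      ((Measure.measurable_lintegral (SimpleFunc.measurable _)).comp hN.measurable)
  simp_rw [hN.lintegral_expNeg_simpleFunc] at h3
  exact tendsto_nhds_unique h3 ((continuous_expNeg.tendsto _).comp h2)

end IsPoissonPointProcess

lemma lintegral_pointMeasure {Ω S : Type*} [MeasurableSpace S] {X : ℕ → Ω → S} {f : S → ℝ≥0∞} (hf : Measurable f) (ω : Ω) :
    ∫⁻ x, f x ∂(pointMeasure X ω) = ∑' i, f (X i ω) := by
  rw [pointMeasure, lintegral_sum_measure]
  exact tsum_congr fun i => lintegral_dirac' _ hf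

end Poisson

/-! ### The intensity `e^{-x} dx` and exceedances of a threshold -/

section ExpIntensity

lemma expIntensity_Ioi (a : ℝ) : expIntensity (Set.Ioi a) = ENNReal.ofReal (Real.exp (-a)) := by
  rw [expIntensity, withDensity_apply _ measurableSet_Ioi, ← integral_exp_neg_Ioi,
    ofReal_integral_eq_lintegral_ofReal (integrableOn_exp_neg_Ioi a)]
  exact ae_of_all _ fun x => (Real.exp_pos _).le

lemma expIntensity_univ : expIntensity Set.univ = ∞ := by
  refine ENNReal.eq_top_of_forall_nnreal_le fun r => ?_
  have h : (r : ℝ≥0∞) ≤ expIntensity (Set.Ioi (-(r : ℝ))) := by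
    rw [expIntensity_Ioi, neg_neg, ← ENNReal.ofReal_coe_nnreal]
    exact ENNReal.ofReal_le_ofReal (by linarith [Real.add_one_le_exp (r : ℝ)])
  exact h.trans (measure_mono (Set.subset_univ _))

/-- The condition reads `x > -log v`, and the tail of `e^{-x} dx` beyond that point is `v`. This is
what turns exceedance counts into means of marks. -/
lemma expIntensity_one_lt_mul (v : ℝ≥0∞) :
    expIntensity {x | 1 < ENNReal.ofReal (Real.exp x) * v} = v := by
  rcases eq_or_ne v 0 with rfl | h0
  · simp
  rcases eq_or_ne v ∞ with rfl | h1
  · have : {x : ℝ | 1 < ENNReal.ofReal (Real.exp x) * ∞} = Set.univ := by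
      ext x
      simp [ENNReal.mul_top, Real.exp_pos]
    rw [this, expIntensity_univ]
  · have hv := ENNReal.toReal_pos h0 h1
    have : {x : ℝ | 1 < ENNReal.ofReal (Real.exp x) * v} = Set.Ioi (-Real.log v.toReal) := by
      ext x
      rw [Set.mem_ofPred_eq, Set.mem_Ioi, ← ENNReal.ofReal_toReal h1,
        ← ENNReal.ofReal_mul (Real.exp_pos x).le, ENNReal.one_lt_ofReal,
        ENNReal.toReal_ofReal hv.le, ← Real.log_pos_iff (by positivity),
        Real.log_mul (Real.exp_pos x).ne' hv.ne', Real.log_exp]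
      constructor <;> intro h <;> linarith
    rw [this, expIntensity_Ioi, neg_neg, Real.exp_log hv, ENNReal.ofReal_toReal h1]

instance : SFinite expIntensity := by
  unfold expIntensity
  infer_instance

lemma measurable_ofReal_exp_mul : Measurable fun p : ℝ × ℝ≥0∞ =>
    ENNReal.ofReal (Real.exp p.1) * p.2 := by fun_prop

lemma measurableSet_one_lt_mul :
    MeasurableSet {p : ℝ × ℝ≥0∞ | 1 < ENNReal.ofReal (Real.exp p.1) * p.2} :=
  measurableSet_lt measurable_const measurable_ofReal_exp_mul

lemma lintegral_expIntensity_measure_one_lt (ρ : Measure ℝ≥0∞) [SFinite ρ] :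
    ∫⁻ x, ρ {v | 1 < ENNReal.ofReal (Real.exp x) * v} ∂expIntensity = ∫⁻ v, v ∂ρ := by
  have h1 := Measure.prod_apply (μ := expIntensity) (ν := ρ) measurableSet_one_lt_mul
  have h2 := Measure.prod_apply_symm (μ := expIntensity) (ν := ρ) measurableSet_one_lt_mul
  refine (h1.symm.trans h2).trans (lintegral_congr fun v => ?_)
  exact expIntensity_one_lt_mul v

end ExpIntensity

/-! ### Poisson points with independent marks -/

section Marked

variable {Ω : Type*} [MeasurableSpace Ω] {P : Measure Ω} {X : ℕ → Ω → ℝ} {V : ℕ → Ω → ℝ≥0∞}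
  {ρ : Measure ℝ≥0∞}

/-- The points of a Poisson process with intensity `e^{-x} dx`, together with independent marks
with common law `ρ`. -/
structure IsMarkedSequence (X : ℕ → Ω → ℝ) (V : ℕ → Ω → ℝ≥0∞) (ρ : Measure ℝ≥0∞)
    (P : Measure Ω) : Prop where
  measurable_points : ∀ i, Measurable (X i)
  measurable_marks : ∀ i, Measurable (V i)
  poisson : IsPoissonPointProcess (pointMeasure X) expIntensity P
  indep_marks : iIndepFun V P
  map_eq : ∀ i, P.map (V i) = ρ
  indep : IndepFun (fun ω i => X i ω) (fun ω i => V i ω) P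

namespace IsMarkedSequence

variable [IsProbabilityMeasure P]

lemma isProbabilityMeasure (h : IsMarkedSequence X V ρ P) : IsProbabilityMeasure ρ :=
  h.map_eq 0 ▸ Measure.isProbabilityMeasure_map (h.measurable_marks 0).aemeasurable

/-- Fubini over the points: for frozen points the events on the marks are independent, so the
conditional probability is a product. -/
lemma measure_forall_lt (h : IsMarkedSequence X V ρ P) (n : ℕ) :
    P {ω | ∀ i ∈ Finset.range n, ENNReal.ofReal (Real.exp (X i ω)) * V i ω ≤ 1} =
      ∫⁻ ω, ∏ i ∈ Finset.range n, ρ {v | ENNReal.ofReal (Real.exp (X i ω)) * v ≤ 1} ∂P := by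
  set FX : Ω → ℕ → ℝ := fun ω i => X i ω
  set FV : Ω → ℕ → ℝ≥0∞ := fun ω i => V i ω
  have hFX : Measurable FX := measurable_pi_lambda _ h.measurable_points
  have hFV : Measurable FV := measurable_pi_lambda _ h.measurable_marks
  set s : Set ((ℕ → ℝ) × (ℕ → ℝ≥0∞)) :=
    {p | ∀ i ∈ Finset.range n, ENNReal.ofReal (Real.exp (p.1 i)) * p.2 i ≤ 1}
  have hs : MeasurableSet s := by
    have : s = ⋂ i ∈ Finset.range n, {p | ENNReal.ofReal (Real.exp (p.1 i)) * p.2 i ≤ 1} := by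
      ext p
      simp [s]
    rw [this]
    refine Finset.measurableSet_biInter _ fun i _ => measurableSet_le ?_ measurable_const
    fun_prop
  have hmap := (indepFun_iff_map_prod_eq_prod_map_map hFX.aemeasurable hFV.aemeasurable).1 h.indep
  have hG : ∀ x : ℝ, MeasurableSet {v : ℝ≥0∞ | ENNReal.ofReal (Real.exp x) * v ≤ 1} := fun x =>
    measurableSet_le (by fun_prop) measurable_const
  have hsec : ∀ x : ℕ → ℝ, (P.map FV) (Prod.mk x ⁻¹' s) =
      ∏ i ∈ Finset.range n, ρ {v | ENNReal.ofReal (Real.exp (x i)) * v ≤ 1} := fun x => by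
    have hx : FV ⁻¹' (Prod.mk x ⁻¹' s) =
        ⋂ i ∈ Finset.range n, V i ⁻¹' {v | ENNReal.ofReal (Real.exp (x i)) * v ≤ 1} := by
      ext ω
      simp [s, FV]
    rw [Measure.map_apply hFV (measurable_prodMk_left hs), hx,
      h.indep_marks.measure_inter_preimage_eq_mul _ fun i _ => hG (x i)]
    exact Finset.prod_congr rfl fun i _ => by
      rw [← h.map_eq i, Measure.map_apply (h.measurable_marks i) (hG (x i))]
  have : IsProbabilityMeasure (P.map FV) := Measure.isProbabilityMeasure_map hFV.aemeasurable
  calc P {ω | ∀ i ∈ Finset.range n, ENNReal.ofReal (Real.exp (X i ω)) * V i ω ≤ 1}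
      = (P.map fun ω => (FX ω, FV ω)) s := by
        rw [Measure.map_apply (hFX.prodMk hFV) hs]
        rfl
    _ = ∫⁻ ω, (P.map FV) (Prod.mk (FX ω) ⁻¹' s) ∂P := by
        rw [hmap, Measure.prod_apply hs, lintegral_map (measurable_measure_prodMk_left hs) hFX]
    _ = _ := lintegral_congr fun ω => hsec _

lemma measurable_measure_mul_le (ρ : Measure ℝ≥0∞) [SFinite ρ] :
    Measurable fun x : ℝ => ρ {v | ENNReal.ofReal (Real.exp x) * v ≤ 1} :=
  measurable_measure_prodMk_left
    (measurableSet_le measurable_ofReal_exp_mul measurable_const :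
      MeasurableSet {p : ℝ × ℝ≥0∞ | ENNReal.ofReal (Real.exp p.1) * p.2 ≤ 1})

/-- The probability that no marked point lies above the threshold. -/
theorem measure_forall_le_one (h : IsMarkedSequence X V ρ P) :
    P {ω | ∀ i, ENNReal.ofReal (Real.exp (X i ω)) * V i ω ≤ 1} = expNeg (∫⁻ v, v ∂ρ) := by
  have := h.isProbabilityMeasure
  set G : ℝ → ℝ≥0∞ := fun x => ρ {v | ENNReal.ofReal (Real.exp x) * v ≤ 1}
  have hG : Measurable G := measurable_measure_mul_le ρ
  have hG1 : ∀ x, expNeg (negLog (G x)) = G x := fun x => expNeg_negLog prob_le_one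
  have hlog : Measurable fun x => negLog (G x) := measurable_negLog.comp hG
  have hterm : ∀ n, MeasurableSet
      {ω | ∀ i ∈ Finset.range n, ENNReal.ofReal (Real.exp (X i ω)) * V i ω ≤ 1} := fun n => by
    have : {ω | ∀ i ∈ Finset.range n, ENNReal.ofReal (Real.exp (X i ω)) * V i ω ≤ 1} =
        ⋂ i ∈ Finset.range n, {ω | ENNReal.ofReal (Real.exp (X i ω)) * V i ω ≤ 1} := by
      ext ω
      simp
    rw [this]
    refine Finset.measurableSet_biInter _ fun i _ => measurableSet_le ?_ measurable_const
    exact (ENNReal.measurable_ofReal.comp (Real.measurable_exp.comp (h.measurable_points i))).mul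
      (h.measurable_marks i)
  have hset : {ω | ∀ i, ENNReal.ofReal (Real.exp (X i ω)) * V i ω ≤ 1} =
      ⋂ n, {ω | ∀ i ∈ Finset.range n, ENNReal.ofReal (Real.exp (X i ω)) * V i ω ≤ 1} := by
    ext ω
    simp only [Set.mem_ofPred_eq, Set.mem_iInter, Finset.mem_range]
    exact ⟨fun h n i _ => h i, fun h i => h (i + 1) i i.lt_succ_self⟩
  have hl1 : Tendsto
      (fun n => P {ω | ∀ i ∈ Finset.range n, ENNReal.ofReal (Real.exp (X i ω)) * V i ω ≤ 1})
      atTop (𝓝 (P {ω | ∀ i, ENNReal.ofReal (Real.exp (X i ω)) * V i ω ≤ 1})) := by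
    rw [hset]
    refine tendsto_measure_iInter_atTop (fun n => (hterm n).nullMeasurableSet)
      (fun m n hmn ω hω i hi => hω i ?_) ⟨0, measure_ne_top _ _⟩
    exact Finset.range_subset_range.2 hmn hi
  -- Writing each factor as `exp (-(-log G))` turns the infinite product into a Laplace functional
  -- with test function `-log G`; a factor `G = 0` gives the value `∞`. The constant `1` dominates.
  have hl2 : Tendsto (fun n => ∫⁻ ω, ∏ i ∈ Finset.range n, G (X i ω) ∂P) atTop
      (𝓝 (∫⁻ ω, expNeg (∫⁻ x, negLog (G x) ∂(pointMeasure X ω)) ∂P)) := by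
    refine tendsto_lintegral_of_dominated_convergence (fun _ => 1) (fun n => ?_)
      (fun n => ae_of_all _ fun ω => ?_) (by simp) (ae_of_all _ fun ω => ?_)
    · exact Finset.measurable_prod _ fun i _ => hG.comp (h.measurable_points i)
    · exact Finset.prod_le_one' fun i _ => prob_le_one
    · have : ∀ n, ∏ i ∈ Finset.range n, G (X i ω) =
          expNeg (∑ i ∈ Finset.range n, negLog (G (X i ω))) := fun n => by
        rw [expNeg_sum]
        exact Finset.prod_congr rfl fun i _ => (hG1 _).symm
      simp_rw [this, lintegral_pointMeasure hlog]
      exact (continuous_expNeg.tendsto _).comp (ENNReal.tendsto_nat_tsum _)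
  simp_rw [h.measure_forall_lt] at hl1
  rw [tendsto_nhds_unique hl1 hl2, h.poisson.lintegral_expNeg_lintegral hlog,
    ← lintegral_expIntensity_measure_one_lt ρ]
  congr 1
  refine lintegral_congr fun x => ?_
  rw [hG1, ← prob_compl_eq_one_sub (measurableSet_le (by fun_prop) measurable_const)]
  congr 1
  ext v
  simp

lemma measure_one_lt (h : IsMarkedSequence X V ρ P) (i : ℕ) :
    P {ω | 1 < ENNReal.ofReal (Real.exp (X i ω)) * V i ω} =
      ∫⁻ ω, ρ {v | 1 < ENNReal.ofReal (Real.exp (X i ω)) * v} ∂P := by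
  have hX := h.measurable_points i
  have hV := h.measurable_marks i
  have hi : IndepFun (X i) (V i) P :=
    h.indep.comp (measurable_pi_apply i) (measurable_pi_apply i)
  have hmap := (indepFun_iff_map_prod_eq_prod_map_map hX.aemeasurable hV.aemeasurable).1 hi
  have := h.isProbabilityMeasure
  rw [h.map_eq] at hmap
  calc P {ω | 1 < ENNReal.ofReal (Real.exp (X i ω)) * V i ω}
      = (P.map fun ω => (X i ω, V i ω))
          {p : ℝ × ℝ≥0∞ | 1 < ENNReal.ofReal (Real.exp p.1) * p.2} := by
        rw [Measure.map_apply (hX.prodMk hV) measurableSet_one_lt_mul]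
        rfl
    _ = _ := by
        rw [hmap, Measure.prod_apply measurableSet_one_lt_mul,
          lintegral_map (measurable_measure_prodMk_left measurableSet_one_lt_mul) hX]
        rfl

/-- If the marks have a finite mean, only finitely many marked points lie above the threshold. -/
theorem ae_finite_one_lt (h : IsMarkedSequence X V ρ P) (hρ : ∫⁻ v, v ∂ρ ≠ ∞) :
    ∀ᵐ ω ∂P, {i | 1 < ENNReal.ofReal (Real.exp (X i ω)) * V i ω}.Finite := by
  have := h.isProbabilityMeasure
  set A : ℕ → Set Ω := fun i => {ω | 1 < ENNReal.ofReal (Real.exp (X i ω)) * V i ω}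
  have hA : ∀ i, MeasurableSet (A i) := fun i => measurableSet_one_lt_mul.preimage
    ((h.measurable_points i).prodMk (h.measurable_marks i))
  have hH : Measurable fun x : ℝ => ρ {v | 1 < ENNReal.ofReal (Real.exp x) * v} :=
    measurable_measure_prodMk_left measurableSet_one_lt_mul
  have hm : ∀ i, Measurable ((A i).indicator fun _ => (1 : ℝ≥0∞)) := fun i =>
    measurable_const.indicator (hA i)
  -- The expected number of exceedances equals the mean mark, by Campbell's formula.
  have hint : ∫⁻ ω, ∑' i, (A i).indicator (fun _ => (1 : ℝ≥0∞)) ω ∂P = ∫⁻ v, v ∂ρ := by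
    rw [lintegral_tsum fun i => (hm i).aemeasurable, ← lintegral_expIntensity_measure_one_lt,
      ← h.poisson.lintegral_lintegral hH]
    simp_rw [lintegral_pointMeasure hH]
    have hHX : ∀ i, Measurable fun ω => ρ {v | 1 < ENNReal.ofReal (Real.exp (X i ω)) * v} :=
      fun i => hH.comp (h.measurable_points i)
    rw [lintegral_tsum fun i => (hHX i).aemeasurable]
    refine tsum_congr fun i => ?_
    rw [lintegral_indicator_const (hA i), one_mul]
    exact h.measure_one_lt i
  filter_upwards [ae_lt_top (Measurable.tsum hm) (hint ▸ hρ)] with ω hω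
  refine (ENNReal.finite_const_le_of_tsum_ne_top hω.ne one_ne_zero).subset fun i hi => ?_
  rw [Set.mem_ofPred_eq, Set.indicator_of_mem (show ω ∈ A i from hi)]

end IsMarkedSequence

end Marked

/-! ### Uniform exponential moments of Gaussian suprema -/

section Fernique

variable {Ω T : Type*} [MeasurableSpace Ω] {P : Measure Ω}

/-- A bound for exponential moments of the supremum of a centred Gaussian vector, uniform over all
vectors which are bounded by `a` with probability at least `3/4`. -/
lemma exists_lintegral_sup_exp_le {a : ℝ} (ha : 0 < a) :
    ∃ C : ℝ≥0∞, C ≠ ∞ ∧ ∀ (W : T → Ω → ℝ), IsGaussianProcess W P → (∀ t, ∫ ω, W t ω ∂P = 0) →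
      ∀ I : Finset T, 3 / 4 ≤ P {ω | ∀ t ∈ I, |W t ω| ≤ a} →
        ∫⁻ ω, I.sup (fun t => ENNReal.ofReal (Real.exp (W t ω))) ∂P ≤ C := by
  set c : ℝ≥0∞ := 3 / 4
  have h34 : c = ENNReal.ofReal (3 / 4) := by
    rw [ENNReal.ofReal_div_of_pos (by norm_num)]
    simp [c]
  have hc_gt : 2⁻¹ < c := by
    rw [h34, ← ENNReal.ofReal_ofNat 2, ← ENNReal.ofReal_inv_of_pos (by norm_num),
      ENNReal.ofReal_lt_ofReal_iff (by norm_num)]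
    norm_num
  have hc_lt : c < 1 := by
    rw [h34, ENNReal.ofReal_lt_one]
    norm_num
  have hratio : 1 < (c / (1 - c)).toReal := by
    rw [ENNReal.toReal_div, ENNReal.toReal_sub_of_le hc_lt.le ENNReal.one_ne_top, h34,
      ENNReal.toReal_ofReal (by norm_num)]
    norm_num
  set δ := Fernique.logRatio c * a⁻¹ ^ 2
  have hδ : 0 < δ := mul_pos (Fernique.logRatio_pos hc_gt hc_lt) (by positivity)
  set K : ℝ≥0∞ := ENNReal.ofReal (Real.exp (Fernique.logRatio c)) +
    ∑' n : ℕ, ENNReal.ofReal (Real.exp (-2⁻¹ * Real.log (c / (1 - c)).toReal * 2 ^ n))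
  have hK : K ≠ ∞ := by
    refine ENNReal.add_ne_top.2 ⟨ENNReal.ofReal_ne_top, (Summable.tsum_ofReal_lt_top ?_).ne⟩
    refine Real.summable_exp_nat_mul_of_ge ?_ fun i => mod_cast (Nat.lt_pow_self (by simp)).le
    exact mul_neg_of_neg_of_pos (by simp) (Real.log_pos hratio)
  refine ⟨(1 + ENNReal.ofReal (Real.exp (1 / (4 * δ)))) * K,
    ENNReal.mul_ne_top (by simp) hK, fun W hW hmean I hI => ?_⟩
  have hP := hW.isProbabilityMeasure
  have hG := hW.hasGaussianLaw I
  set R : Ω → I → ℝ := fun ω => I.restrict (W · ω)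
  set μ := P.map R
  have hRm : AEMeasurable R P := hG.aemeasurable
  have : IsGaussian μ := hG.isGaussian_map
  have hμ0 : ∫ x, id x ∂μ = 0 := by
    rw [integral_map hRm (by fun_prop)]
    ext t
    exact (eval_integral (fun t => (hW.hasGaussianLaw_eval t.1).integrable) t).trans (hmean t)
  have hball : c ≤ μ {x | ‖x‖ ≤ a} := by
    rw [Measure.map_apply_of_aemeasurable hRm (measurableSet_le (by fun_prop) (by fun_prop))]
    refine hI.trans (measure_mono fun ω hω => ?_)
    exact (pi_norm_le_iff_of_nonneg ha.le).2 fun t => hω t t.2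
  have key := lintegral_exp_mul_sq_norm_le_of_map_rotation_eq_self
    (IsGaussian.map_rotation_eq_self hμ0 _) hball hc_gt
  rw [lintegral_map' (by fun_prop) hRm] at key
  have hpt : ∀ ω, I.sup (fun t => ENNReal.ofReal (Real.exp (W t ω))) ≤
      (1 + ENNReal.ofReal (Real.exp (1 / (4 * δ)))) *
        ENNReal.ofReal (Real.exp (δ * ‖R ω‖ ^ 2)) := fun ω => by
    refine Finset.sup_le fun t ht => ?_
    refine le_trans ?_ (mul_le_mul_left le_add_self _)
    rw [← ENNReal.ofReal_mul (Real.exp_pos _).le, ← Real.exp_add]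
    refine ENNReal.ofReal_le_ofReal (Real.exp_le_exp.2 ?_)
    have h1 : W t ω ≤ ‖R ω‖ := (le_abs_self _).trans (norm_le_pi_norm (R ω) ⟨t, ht⟩)
    -- Completing the square gives `r ≤ 1 / (4 * δ) + δ * r ^ 2`, so Fernique's Gaussian moment
    -- controls the exponential one.
    have h2 : 1 / (4 * δ) + δ * ‖R ω‖ ^ 2 - ‖R ω‖ = δ * (‖R ω‖ - 1 / (2 * δ)) ^ 2 := by
      field_simp
      ring
    have h3 : 0 ≤ δ * (‖R ω‖ - 1 / (2 * δ)) ^ 2 := by positivity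
    linarith
  refine (lintegral_mono hpt).trans ?_
  rw [lintegral_const_mul' _ _ (by simp)]
  exact mul_le_mul_right key _

end Fernique

/-! ### Integrability of the supremum of `exp W` over balls -/

section SupExp

variable {d : ℕ}

/-- The points of a fixed dense sequence with index less than `n`, in the ball of radius `m`. -/
noncomputable def denseBall (d : ℕ) (m n : ℕ) : Finset (Space d) := by
  classical
  exact ((Finset.range n).image (TopologicalSpace.denseSeq (Space d))).filter fun t => ‖t‖ < m

lemma mem_denseBall {m n : ℕ} {t : Space d} : t ∈ denseBall d m n ↔
    (∃ k < n, TopologicalSpace.denseSeq (Space d) k = t) ∧ ‖t‖ < m := by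
  simp [denseBall]

lemma monotone_denseBall (m : ℕ) : Monotone (denseBall d m) := fun _ _ hij t ht => by
  rw [mem_denseBall] at ht ⊢
  obtain ⟨⟨k, hk, hkt⟩, h⟩ := ht
  exact ⟨⟨k, hk.trans_le hij, hkt⟩, h⟩

/-- The supremum of `exp ∘ f` over a countable dense subset of the ball of radius `m`. -/
noncomputable def supExp (m : ℕ) (f : Space d → ℝ) : ℝ≥0∞ :=
  ⨆ n, (denseBall d m n).sup fun t => ENNReal.ofReal (Real.exp (f t))

lemma measurable_finsetSup {ι α : Type*} [MeasurableSpace α] (I : Finset ι) {g : ι → α → ℝ≥0∞}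
    (hg : ∀ t, Measurable (g t)) : Measurable fun x => I.sup fun t => g t x := by
  simp_rw [Finset.sup_eq_iSup]
  exact Measurable.biSup _ I.countable_toSet fun t _ => hg t

lemma measurable_supExp (m : ℕ) : Measurable (supExp (d := d) m) :=
  Measurable.iSup fun _ => measurable_finsetSup _ fun t =>
    ENNReal.measurable_ofReal.comp (Real.measurable_exp.comp (measurable_pi_apply t))

/-- By continuity, a violation at `t` would persist on an open subset of the ball, which contains a
point of the dense sequence. -/
lemma exp_le_supExp {m : ℕ} {f : Space d → ℝ} (hf : Continuous f) {t : Space d} (ht : ‖t‖ < m) :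
    ENNReal.ofReal (Real.exp (f t)) ≤ supExp m f := by
  by_contra! h
  have hg : Continuous fun s => ENNReal.ofReal (Real.exp (f s)) :=
    ENNReal.continuous_ofReal.comp (Real.continuous_exp.comp hf)
  have hopen : IsOpen ({s : Space d | ‖s‖ < m} ∩
      {s | supExp m f < ENNReal.ofReal (Real.exp (f s))}) :=
    (isOpen_lt continuous_norm continuous_const).inter (isOpen_lt continuous_const hg)
  obtain ⟨k, hk1, hk2⟩ := (TopologicalSpace.denseRange_denseSeq (Space d)).exists_mem_open hopen
    ⟨t, ht, h⟩
  refine absurd ?_ (not_le.2 (Set.mem_ofPred_eq ▸ hk2))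
  refine le_trans ?_ (le_iSup _ (k + 1))
  exact Finset.le_sup (f := fun t => ENNReal.ofReal (Real.exp (f t)))
    (mem_denseBall.2 ⟨⟨k, k.lt_succ_self, rfl⟩, hk1⟩)

variable {Ω : Type*} [MeasurableSpace Ω] {P : Measure Ω} [IsProbabilityMeasure P]

/-- The exponential of a centred Gaussian field with continuous paths has an integrable supremum
over balls. -/
theorem lintegral_supExp_ne_top {W : Space d → Ω → ℝ} (hm : IsRandomField W)
    (hc : ∀ᵐ ω ∂P, Continuous (path W ω)) (hG : IsGaussianProcess W P)
    (h0 : ∀ t, ∫ ω, W t ω ∂P = 0) (m : ℕ) :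
    ∫⁻ ω, supExp m (path W ω) ∂P ≠ ∞ := by
  -- Continuous paths are bounded on the closed ball, so `P (A k)` increases to `1` and exceeds `3 /
  -- 4` for some `k`. This one `k` serves all finite sets `denseBall d m n`, so the Fernique bound
  -- is uniform in `n` and survives monotone convergence.
  set A : ℕ → Set Ω := fun k => {ω | ∀ n, ∀ t ∈ denseBall d m n, |W t ω| ≤ k}
  have hAmono : Monotone A := fun i j hij ω hω n t ht =>
    (hω n t ht).trans (Nat.cast_le.2 hij)
  have hAu : P (⋃ k, A k) = 1 := by
    rw [← measure_univ (μ := P)]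
    refine measure_congr (eventuallyEq_univ.2 ?_)
    filter_upwards [hc] with ω hω
    obtain ⟨C, hC⟩ := (isCompact_closedBall (0 : Space d) m).exists_bound_of_continuousOn
      hω.continuousOn
    obtain ⟨k, hk⟩ := exists_nat_ge C
    refine Set.mem_iUnion.2 ⟨k, fun n t ht => (hC t ?_).trans hk⟩
    rw [mem_closedBall_zero_iff]
    exact (mem_denseBall.1 ht).2.le
  have hlt : (3 / 4 : ℝ≥0∞) < 1 := by
    rw [ENNReal.div_lt_iff (by simp) (by simp)]
    norm_num
  obtain ⟨k, hk, hk0⟩ := (((tendsto_measure_iUnion_atTop hAmono).eventually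
    (lt_mem_nhds (hAu ▸ hlt : (3 / 4 : ℝ≥0∞) < P (⋃ k, A k)))).and
      (eventually_gt_atTop 0)).exists
  obtain ⟨C, hC, hbound⟩ := exists_lintegral_sup_exp_le (P := P) (T := Space d)
    (Nat.cast_pos.2 hk0 : (0 : ℝ) < k)
  refine ne_top_of_le_ne_top hC ?_
  unfold supExp
  have hmeas : ∀ n, Measurable fun ω =>
      (denseBall d m n).sup fun t => ENNReal.ofReal (Real.exp (path W ω t)) := fun n =>
    measurable_finsetSup _ fun t => ENNReal.measurable_ofReal.comp (Real.measurable_exp.comp (hm t))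
  rw [lintegral_iSup hmeas
    fun i j hij ω => Finset.sup_mono (monotone_denseBall m hij)]
  exact iSup_le fun n => hbound W hG h0 _ (hk.le.trans (measure_mono fun ω hω t ht => hω n t ht))

end SupExp

/-! ### Measures determined by moment generating functions -/

section MGF

/-- Finite measures on a Banach space for which the moment generating functions of all continuous
linear functionals are finite and agree are equal. -/
lemma ext_of_mgf_strongDual {E : Type*} [NormedAddCommGroup E] [NormedSpace ℝ E] [CompleteSpace E]
    [SecondCountableTopology E] [MeasurableSpace E] [BorelSpace E] {μ ν : Measure E}
    [IsFiniteMeasure μ] [IsFiniteMeasure ν]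
    (hint : ∀ (L : StrongDual ℝ E) (s : ℝ), Integrable (fun x => Real.exp (s * L x)) μ)
    (h : ∀ L : StrongDual ℝ E, mgf L μ = mgf L ν) : μ = ν := by
  have hzero : μ = 0 ↔ ν = 0 := by
    have := congrFun (h 0) 0
    rw [mgf_zero', mgf_zero'] at this
    rw [← Measure.measure_univ_eq_zero, ← Measure.measure_univ_eq_zero (μ := ν),
      ← measureReal_eq_zero_iff, ← measureReal_eq_zero_iff (μ := ν), this]
  refine Measure.ext_of_charFunDual (funext fun L => ?_)
  -- Finiteness at every real `s` extends the equality to the whole complex plane; at `I` it is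
  -- equality of characteristic functions.
  have hset : integrableExpSet L μ = Set.univ := Set.eq_univ_of_forall (hint L)
  have := eqOn_complexMGF_of_mgf' (h L) hzero (x := Complex.I) (by simp [hset])
  simpa [complexMGF, charFunDual_apply, mul_comm Complex.I] using this

end MGF

/-! ### The drifted field, its tilted increments and the exponent -/

section DriftedField

variable {d : ℕ} {Ω₀ : Type*} [MeasurableSpace Ω₀] {ι : Type*}

/-- The drifted field `t ↦ W(t) - σ²(t)/2`. -/
noncomputable def drifted (W : Space d → Ω₀ → ℝ) (P₀ : Measure Ω₀)
    (t : Space d) (ω : Ω₀) : ℝ :=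
  W t ω - Var[W t; P₀] / 2

/-- The law of the increments `ξ(x i) - ξ(x k)` of the drifted field `ξ`, tilted by
`exp (ξ(x k))`. -/
noncomputable def tiltedLaw (W : Space d → Ω₀ → ℝ) (P₀ : Measure Ω₀)
    (x : ι → Space d) (k : ι) : Measure (ι → ℝ) :=
  (P₀.withDensity fun ω => ENNReal.ofReal (Real.exp (drifted W P₀ (x k) ω))).map
    fun ω i => drifted W P₀ (x i) ω - drifted W P₀ (x k) ω

/-- The exponent function `E sup_i exp (ξ(x i) - y i)` of the drifted field `ξ`. -/
noncomputable def exponent [Fintype ι] (W : Space d → Ω₀ → ℝ) (P₀ : Measure Ω₀)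
    (x : ι → Space d) (y : ι → ℝ) : ℝ≥0∞ :=
  ∫⁻ ω, Finset.univ.sup (fun i => ENNReal.ofReal (Real.exp (drifted W P₀ (x i) ω - y i))) ∂P₀

end DriftedField

namespace IsDrivingField

variable {d : ℕ} {Ω₀ : Type*} [MeasurableSpace Ω₀] {P₀ : Measure Ω₀}
  {W : Space d → Ω₀ → ℝ} {γ : Space d → ℝ}

lemma memLp_two (hW : IsDrivingField W P₀ γ) (t : Space d) : MemLp (W t) 2 P₀ :=
  (hW.gaussian.hasGaussianLaw_eval t).memLp_two

lemma integrable (hW : IsDrivingField W P₀ γ) (t : Space d) : Integrable (W t) P₀ :=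
  (hW.gaussian.hasGaussianLaw_eval t).integrable

/-- For the increment field of lag `s - t`, weak stationarity moves the base point from `t` to `0`;
centring turns the variance there into the second moment defining `γ`. -/
lemma variance_sub (hW : IsDrivingField W P₀ γ) (s t : Space d) :
    Var[fun ω => W s ω - W t ω; P₀] = 2 * γ (s - t) := by
  have := hW.gaussian.isProbabilityMeasure
  have h1 := (hW.intrinsicallyStationary (s - t)).cov_eq 0 t 0
  have hm : ∀ u v, AEMeasurable (fun ω => W u ω - W v ω) P₀ := fun u v =>
    ((hW.isRandomField u).sub (hW.isRandomField v)).aemeasurable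
  simp only [zero_add, add_zero, add_sub_cancel] at h1
  rw [covariance_self (hm _ _), covariance_self (hm _ _)] at h1
  rw [h1, ← hW.variogram_eq, variogram, variance_of_integral_eq_zero (hm _ _)]
  · ring
  · rw [integral_sub (hW.integrable _) (hW.integrable _), hW.centred, hW.centred, sub_zero]

lemma covariance_eq (hW : IsDrivingField W P₀ γ) (s t : Space d) :
    cov[W s, W t; P₀] = (Var[W s; P₀] + Var[W t; P₀]) / 2 - γ (s - t) := by
  have := hW.gaussian.isProbabilityMeasure
  have h := variance_fun_sub (hW.memLp_two s) (hW.memLp_two t)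
  rw [hW.variance_sub] at h
  linarith

lemma measurable_drifted (hW : IsDrivingField W P₀ γ) (t : Space d) :
    Measurable (drifted W P₀ t) :=
  (hW.isRandomField t).sub_const _

variable {ι : Type*}

lemma measurable_increments (hW : IsDrivingField W P₀ γ) (x : ι → Space d) (k : ι) :
    Measurable fun ω i => drifted W P₀ (x i) ω - drifted W P₀ (x k) ω :=
  measurable_pi_lambda _ fun _ => (hW.measurable_drifted _).sub (hW.measurable_drifted _)

lemma measurable_density (hW : IsDrivingField W P₀ γ) (t : Space d) :
    Measurable fun ω => ENNReal.ofReal (Real.exp (drifted W P₀ t ω)) :=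
  ENNReal.measurable_ofReal.comp (Real.measurable_exp.comp (hW.measurable_drifted t))

lemma lintegral_tiltedLaw (hW : IsDrivingField W P₀ γ) (x : ι → Space d) (k : ι)
    {f : (ι → ℝ) → ℝ≥0∞} (hf : Measurable f) :
    ∫⁻ v, f v ∂(tiltedLaw W P₀ x k) =
      ∫⁻ ω, ENNReal.ofReal (Real.exp (drifted W P₀ (x k) ω)) *
        f (fun i => drifted W P₀ (x i) ω - drifted W P₀ (x k) ω) ∂P₀ := by
  rw [tiltedLaw, lintegral_map hf (hW.measurable_increments x k)]
  exact lintegral_withDensity_eq_lintegral_mul _ (hW.measurable_density _)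
    (hf.comp (hW.measurable_increments x k))

variable [Fintype ι]

lemma hasGaussianLaw_sum (hW : IsDrivingField W P₀ γ) (x : ι → Space d) (a : ι → ℝ) :
    HasGaussianLaw (fun ω => ∑ i, a i * W (x i) ω) P₀ := by
  have h := ((hW.gaussian.comp_right x).smul a).hasGaussianLaw_fun_sum (I := Finset.univ)
  simpa using h

/-- When the weights sum to `1`, the variances of `W` enter only linearly, exactly as the drift
`-σ²/2` can cancel them in an exponential moment. -/
lemma variance_sum (hW : IsDrivingField W P₀ γ) (x : ι → Space d) {a : ι → ℝ}
    (ha : ∑ i, a i = 1) :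
    Var[fun ω => ∑ i, a i * W (x i) ω; P₀] =
      ∑ i, a i * Var[W (x i); P₀] - ∑ i, ∑ j, a i * a j * γ (x i - x j) := by
  have := hW.gaussian.isProbabilityMeasure
  have hmem : ∀ i, MemLp (fun ω => a i * W (x i) ω) 2 P₀ := fun i =>
    (hW.memLp_two (x i)).const_mul (a i)
  rw [← covariance_self (hW.hasGaussianLaw_sum x a).aemeasurable,
    covariance_fun_sum_fun_sum hmem hmem]
  have h1 : ∀ i j, cov[fun ω => a i * W (x i) ω, fun ω => a j * W (x j) ω; P₀] =
      (a i * Var[W (x i); P₀]) * a j / 2 + a i * (a j * Var[W (x j); P₀]) / 2 -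
        a i * a j * γ (x i - x j) := fun i j => by
    rw [covariance_const_mul_left, covariance_const_mul_right, hW.covariance_eq]
    ring
  simp_rw [h1, Finset.sum_sub_distrib, Finset.sum_add_distrib, ← Finset.sum_div, ← Finset.mul_sum,
    ← Finset.sum_mul, ha]
  ring

lemma integrable_exp_sum (hW : IsDrivingField W P₀ γ) (x : ι → Space d) (a : ι → ℝ) :
    Integrable (fun ω => Real.exp (∑ i, a i * drifted W P₀ (x i) ω)) P₀ := by
  have := hW.gaussian.isProbabilityMeasure
  have hlaw := (hW.hasGaussianLaw_sum x a).map_eq_gaussianReal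
  have h1 : Integrable (fun ω => Real.exp (∑ i, a i * W (x i) ω)) P₀ := by
    have h2 := integrable_exp_mul_gaussianReal
      (μ := P₀[fun ω => ∑ i, a i * W (x i) ω])
      (v := Var[fun ω => ∑ i, a i * W (x i) ω; P₀].toNNReal) 1
    rw [← hlaw] at h2
    have h3 := (integrable_map_measure (by fun_prop)
      (hW.hasGaussianLaw_sum x a).aemeasurable).1 h2
    simpa [Function.comp_def] using h3
  refine (h1.mul_const (Real.exp (-∑ i, a i * (Var[W (x i); P₀] / 2)))).congr
    (ae_of_all _ fun ω => ?_)
  simp only [drifted]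
  rw [← Real.exp_add, ← sub_eq_add_neg, ← Finset.sum_sub_distrib]
  simp_rw [mul_sub]

/-- Exponential moments of affine combinations of the drifted field depend only on the
variogram. -/
lemma integral_exp_sum (hW : IsDrivingField W P₀ γ) (x : ι → Space d) {a : ι → ℝ}
    (ha : ∑ i, a i = 1) :
    ∫ ω, Real.exp (∑ i, a i * drifted W P₀ (x i) ω) ∂P₀ =
      Real.exp (-(∑ i, ∑ j, a i * a j * γ (x i - x j)) / 2) := by
  have := hW.gaussian.isProbabilityMeasure
  have hlaw := (hW.hasGaussianLaw_sum x a).map_eq_gaussianReal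
  have hmean : ∫ ω, ∑ i, a i * W (x i) ω ∂P₀ = 0 := by
    rw [integral_finsetSum _ fun i _ => (hW.integrable (x i)).const_mul (a i)]
    simp [integral_const_mul, hW.centred]
  have h1 := mgf_gaussianReal hlaw 1
  rw [hmean, Real.coe_toNNReal _ (variance_nonneg _ _), hW.variance_sum x ha] at h1
  simp only [mgf, one_mul, zero_add, one_pow, mul_one] at h1
  have h2 : ∀ ω, Real.exp (∑ i, a i * drifted W P₀ (x i) ω) =
      Real.exp (∑ i, a i * W (x i) ω) * Real.exp (-(∑ i, a i * Var[W (x i); P₀]) / 2) := fun ω => by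
    simp only [drifted]
    rw [← Real.exp_add, neg_div, ← sub_eq_add_neg, Finset.sum_div, ← Finset.sum_sub_distrib]
    congr 1
    exact Finset.sum_congr rfl fun i _ => by ring
  simp_rw [h2]
  rw [integral_mul_const, h1, ← Real.exp_add]
  congr 1
  ring

/-- The tilt contributes one extra copy of `ξ(x k)` while the increments carry total weight `0`; the
combined weights `a` therefore sum to `1`. -/
lemma lintegral_exp_tiltedLaw [DecidableEq ι] (hW : IsDrivingField W P₀ γ) (x : ι → Space d) (k : ι)
    (u : ι → ℝ) {a : ι → ℝ} (ha : a = u + Pi.single k (1 - ∑ i, u i)) :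
    ∫⁻ v, ENNReal.ofReal (Real.exp (∑ i, u i * v i)) ∂(tiltedLaw W P₀ x k) =
      ENNReal.ofReal (Real.exp (-(∑ i, ∑ j, a i * a j * γ (x i - x j)) / 2)) := by
  have ha1 : ∑ i, a i = 1 := by
    simp [ha, Finset.sum_add_distrib]
  rw [hW.lintegral_tiltedLaw x k (by fun_prop), ← hW.integral_exp_sum x ha1,
    ofReal_integral_eq_lintegral_ofReal (hW.integrable_exp_sum x a)
      (ae_of_all _ fun ω => (Real.exp_pos _).le)]
  refine lintegral_congr fun ω => ?_
  rw [← ENNReal.ofReal_mul (Real.exp_pos _).le, ← Real.exp_add]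
  congr 2
  simp_rw [ha, Pi.add_apply, add_mul, mul_sub, Finset.sum_add_distrib, Finset.sum_sub_distrib,
    ← Finset.sum_mul]
  have hs : ∀ (c : ℝ) (f : ι → ℝ), ∑ i, (Pi.single k c : ι → ℝ) i * f i = c * f k := fun c f => by
    simp [Pi.single_apply]
  rw [hs]
  ring

lemma isFiniteMeasure_tiltedLaw (hW : IsDrivingField W P₀ γ) (x : ι → Space d) (k : ι) :
    IsFiniteMeasure (tiltedLaw W P₀ x k) := by
  classical
  refine ⟨?_⟩
  have h := hW.lintegral_exp_tiltedLaw x k 0 rfl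
  simp only [Pi.zero_apply, zero_mul, Finset.sum_const_zero, Real.exp_zero, ENNReal.ofReal_one,
    lintegral_one] at h
  rw [h]
  exact ENNReal.ofReal_lt_top

/-- The tilted law of the increments depends only on the variogram of the increments. -/
lemma tiltedLaw_eq {d' : ℕ} {Ω₁ : Type*} [MeasurableSpace Ω₁] {P₁ : Measure Ω₁}
    {W' : Space d' → Ω₁ → ℝ} {γ' : Space d' → ℝ} (hW : IsDrivingField W P₀ γ)
    (hW' : IsDrivingField W' P₁ γ') {x : ι → Space d} {x' : ι → Space d'}
    (hx : ∀ i j, γ (x i - x j) = γ' (x' i - x' j)) (k : ι) :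
    tiltedLaw W P₀ x k = tiltedLaw W' P₁ x' k := by
  classical
  have h1 := hW.isFiniteMeasure_tiltedLaw x k
  have h2 := hW'.isFiniteMeasure_tiltedLaw x' k
  have hL : ∀ (L : StrongDual ℝ (ι → ℝ)) (s : ℝ) (v : ι → ℝ),
      s * L v = ∑ i, (s * L (Pi.single i 1)) * v i := fun L s v => by
    conv_lhs => rw [pi_eq_sum_univ' v]
    simp_rw [map_sum, map_smul, smul_eq_mul, Finset.mul_sum]
    exact Finset.sum_congr rfl fun i _ => by ring
  have hlin : ∀ (ν : Measure (ι → ℝ)) (L : StrongDual ℝ (ι → ℝ)) (s : ℝ),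
      ∫⁻ v, ENNReal.ofReal (Real.exp (s * L v)) ∂ν =
        ∫⁻ v, ENNReal.ofReal (Real.exp (∑ i, (s * L (Pi.single i 1)) * v i)) ∂ν := fun ν L s =>
    lintegral_congr fun v => by rw [hL]
  have hexp : ∀ (L : StrongDual ℝ (ι → ℝ)) (s : ℝ),
      Measurable fun v => Real.exp (s * L v) := fun L s => by fun_prop
  refine ext_of_mgf_strongDual (fun L s => ⟨(hexp L s).aestronglyMeasurable, ?_⟩)
    fun L => funext fun s => ?_
  · rw [hasFiniteIntegral_iff_ofReal (ae_of_all _ fun v => (Real.exp_pos _).le)]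
    rw [hlin, hW.lintegral_exp_tiltedLaw x k _ rfl]
    exact ENNReal.ofReal_lt_top
  · rw [mgf, mgf, integral_eq_lintegral_of_nonneg_ae (ae_of_all _ fun v => (Real.exp_pos _).le)
      (hexp L s).aestronglyMeasurable, integral_eq_lintegral_of_nonneg_ae
      (ae_of_all _ fun v => (Real.exp_pos _).le) (hexp L s).aestronglyMeasurable]
    rw [hlin, hlin, hW.lintegral_exp_tiltedLaw x k _ rfl, hW'.lintegral_exp_tiltedLaw x' k _ rfl]
    simp_rw [hx]

lemma exponent_eq_lintegral_tiltedLaw (hW : IsDrivingField W P₀ γ) (x : ι → Space d) (y : ι → ℝ)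
    (k : ι) :
    exponent W P₀ x y =
      ∫⁻ v, Finset.univ.sup (fun i => ENNReal.ofReal (Real.exp (v i - y i)))
        ∂(tiltedLaw W P₀ x k) := by
  rw [hW.lintegral_tiltedLaw x k (measurable_finsetSup _ fun i => by fun_prop)]
  refine lintegral_congr fun ω => ?_
  simp_rw [Finset.sup_eq_iSup, ENNReal.mul_iSup]
  refine iSup_congr fun i => iSup_congr fun _ => ?_
  rw [← ENNReal.ofReal_mul (Real.exp_pos _).le, ← Real.exp_add]
  congr 2
  ring

/-- Allowing two fields and two configurations covers both uses: the same field at translated points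
gives stationarity, and two fields at the same points give dependence on `γ` alone. -/
theorem exponent_eq {d' : ℕ} {Ω₁ : Type*} [MeasurableSpace Ω₁] {P₁ : Measure Ω₁}
    {W' : Space d' → Ω₁ → ℝ} {γ' : Space d' → ℝ} (hW : IsDrivingField W P₀ γ)
    (hW' : IsDrivingField W' P₁ γ') {x : ι → Space d} {x' : ι → Space d'}
    (hx : ∀ i j, γ (x i - x j) = γ' (x' i - x' j)) (y : ι → ℝ) :
    exponent W P₀ x y = exponent W' P₁ x' y := by
  rcases isEmpty_or_nonempty ι with hι | ⟨⟨k⟩⟩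
  · simp [exponent]
  · rw [hW.exponent_eq_lintegral_tiltedLaw x y k, hW'.exponent_eq_lintegral_tiltedLaw x' y k,
      hW.tiltedLaw_eq hW' hx]

lemma lintegral_exp_drifted_sub (hW : IsDrivingField W P₀ γ) (t : Space d) (y : ℝ) :
    ∫⁻ ω, ENNReal.ofReal (Real.exp (drifted W P₀ t ω - y)) ∂P₀ =
      ENNReal.ofReal (Real.exp (-y)) := by
  have hγ : γ 0 = 0 := by
    rw [← hW.variogram_eq]
    simp [variogram]
  have h1 := hW.lintegral_exp_tiltedLaw (fun _ : Unit => t) () 0 rfl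
  rw [hW.lintegral_tiltedLaw _ _ (by fun_prop)] at h1
  simp only [Pi.zero_apply, Finset.sum_const_zero, Real.exp_zero, ENNReal.ofReal_one,
    mul_one, sub_self, hγ, mul_zero, neg_zero, zero_div] at h1
  simp_rw [sub_eq_add_neg, Real.exp_add, ENNReal.ofReal_mul (Real.exp_pos _).le]
  rw [lintegral_mul_const' _ _ ENNReal.ofReal_ne_top, h1, one_mul]

/-- The exponent function is homogeneous. -/
lemma natCast_mul_exponent_add_log (x : ι → Space d) (y : ι → ℝ) {n : ℕ} (hn : 1 ≤ n) :
    n * exponent W P₀ x (fun i => y i + Real.log n) = exponent W P₀ x y := by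
  have hn0 : (0 : ℝ) < n := by exact_mod_cast hn
  rw [exponent, ← lintegral_const_mul' _ _ (ENNReal.natCast_ne_top n)]
  refine lintegral_congr fun ω => ?_
  simp_rw [Finset.sup_eq_iSup, ENNReal.mul_iSup]
  refine iSup_congr fun i => iSup_congr fun _ => ?_
  rw [← ENNReal.ofReal_natCast, ← ENNReal.ofReal_mul hn0.le, ← sub_sub, Real.exp_sub _ (Real.log n),
    Real.exp_log hn0, mul_div_cancel₀ _ hn0.ne']

end IsDrivingField

/-! ### Laws of fields from joint distribution functions -/

section Laws

lemma measurableSet_forall_le {T : Type*} (I : Finset T) (y : T → ℝ) :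
    MeasurableSet {f : T → ℝ | ∀ t ∈ I, f t ≤ y t} := by
  have : {f : T → ℝ | ∀ t ∈ I, f t ≤ y t} = ⋂ t ∈ I, {f | f t ≤ y t} := by
    ext f
    simp
  rw [this]
  exact Finset.measurableSet_biInter _ fun t _ =>
    measurableSet_le (measurable_pi_apply t) measurable_const

/-- Probability measures on a product of real lines with the same joint distribution functions are
equal. -/
lemma ext_of_forall_le {T : Type*} {μ ν : Measure (T → ℝ)} [IsProbabilityMeasure μ]
    [IsProbabilityMeasure ν]
    (h : ∀ (I : Finset T) (y : T → ℝ),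
      μ {f | ∀ t ∈ I, f t ≤ y t} = ν {f | ∀ t ∈ I, f t ≤ y t}) : μ = ν := by
  classical
  refine ext_of_generate_finite {S | ∃ (I : Finset T) (y : T → ℝ), S = {f | ∀ t ∈ I, f t ≤ y t}}
    (le_antisymm ?_ ?_) ?_ ?_ (by simp)
  · refine iSup_le fun t => ?_
    rw [Real.borelSpace.measurable_eq, borel_eq_generateFrom_Iic,
      MeasurableSpace.comap_generateFrom]
    refine MeasurableSpace.generateFrom_mono ?_
    rintro _ ⟨_, ⟨c, rfl⟩, rfl⟩
    refine ⟨{t}, fun _ => c, ?_⟩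
    ext f
    simp
  · refine MeasurableSpace.generateFrom_le ?_
    rintro _ ⟨I, y, rfl⟩
    exact measurableSet_forall_le I y
  · rintro _ ⟨I, y, rfl⟩ _ ⟨J, z, rfl⟩ -
    -- Closure under intersections: both constraints are merged over `I ∪ J`, with the smaller bound
    -- where they overlap.
    refine ⟨I ∪ J, fun t => if t ∈ I then if t ∈ J then min (y t) (z t) else y t else z t, ?_⟩
    ext f
    simp only [Set.mem_inter_iff, Set.mem_ofPred_eq, Finset.mem_union, ← forall_and]
    refine forall_congr' fun t => ?_
    by_cases h1 : t ∈ I <;> by_cases h2 : t ∈ J <;> simp [h1, h2]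
  · rintro _ ⟨I, y, rfl⟩
    exact h I y

variable {d : ℕ} {Ω Ω' : Type*} [MeasurableSpace Ω] [MeasurableSpace Ω'] {P : Measure Ω}
  {P' : Measure Ω'}

lemma IsRandomField.measurable_path {Z : Space d → Ω → ℝ} (h : IsRandomField Z) :
    Measurable (path Z) :=
  measurable_pi_lambda _ h

lemma identDistrib_of_forall_le [IsProbabilityMeasure P] [IsProbabilityMeasure P']
    {Z : Space d → Ω → ℝ} {Z' : Space d → Ω' → ℝ} (hZ : AEMeasurable (path Z) P)
    (hZ' : AEMeasurable (path Z') P')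
    (h : ∀ (I : Finset (Space d)) (y : Space d → ℝ),
      P {ω | ∀ t ∈ I, Z t ω ≤ y t} = P' {ω | ∀ t ∈ I, Z' t ω ≤ y t}) :
    IdentDistrib (path Z) (path Z') P P' := by
  refine ⟨hZ, hZ', ?_⟩
  have := Measure.isProbabilityMeasure_map hZ
  have := Measure.isProbabilityMeasure_map hZ'
  refine ext_of_forall_le fun I y => ?_
  rw [Measure.map_apply_of_aemeasurable hZ (measurableSet_forall_le I y),
    Measure.map_apply_of_aemeasurable hZ' (measurableSet_forall_le I y)]
  exact h I y

end Laws

/-! ### Finite-dimensional laws and properties of the maximum field -/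

section MaxField

variable {d : ℕ} {γ : Space d → ℝ} {Ω₀ : Type*} [MeasurableSpace Ω₀] {P₀ : Measure Ω₀}
  {Ω : Type*} [MeasurableSpace Ω] {P : Measure Ω}
  {W : Space d → Ω₀ → ℝ} {Wc : ℕ → Space d → Ω → ℝ} {X : ℕ → Ω → ℝ}

lemma lintegral_map_path (hW : IsRandomField W) {v : (Space d → ℝ) → ℝ≥0∞} (hv : Measurable v) :
    ∫⁻ u, u ∂(P₀.map fun ω => v (path W ω)) = ∫⁻ ω, v (path W ω) ∂P₀ :=
  lintegral_map (f := fun u => u) measurable_id (hv.comp hW.measurable_path)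

namespace IsMarkedPoissonSample

lemma isMarkedSequence (hS : IsMarkedPoissonSample W P₀ Wc X P) {v : (Space d → ℝ) → ℝ≥0∞}
    (hv : Measurable v) :
    IsMarkedSequence X (fun i ω => v (path (Wc i) ω)) (P₀.map fun ω => v (path W ω)) P where
  measurable_points := hS.measurable_points
  measurable_marks i := hv.comp (hS.isRandomField i).measurable_path
  poisson := hS.poisson
  indep_marks := hS.indep_copies.comp (fun _ => v) fun _ => hv
  map_eq i := ((hS.identDistrib i).comp hv).map_eq
  indep := hS.indep.comp measurable_id
    (measurable_pi_lambda _ fun i => hv.comp (measurable_pi_apply i) :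
      Measurable fun (w : ℕ → Space d → ℝ) i => v (w i))

lemma isRandomField_maxField (hS : IsMarkedPoissonSample W P₀ Wc X P) :
    IsRandomField (maxField W P₀ Wc X) := fun t =>
  Measurable.iSup fun i =>
    ((hS.measurable_points i).add (hS.isRandomField i t)).sub_const _

variable [IsProbabilityMeasure P]

/-- Almost surely, the maximum is attained simultaneously at all locations. -/
theorem ae_isGreatest (hW : IsDrivingField W P₀ γ) (hS : IsMarkedPoissonSample W P₀ Wc X P) :
    ∀ᵐ ω ∂P, ∀ t, IsGreatest (Set.range fun i => term W P₀ Wc X i t ω)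
      (maxField W P₀ Wc X t ω) := by
  have hP₀ := hW.gaussian.isProbabilityMeasure
  -- Integer radii `m` and scales `c` suffice, so a single null set serves all uncountably many `t`.
  have hfin : ∀ m c : ℕ, ∀ᵐ ω ∂P, {i | 1 < ENNReal.ofReal (Real.exp (X i ω)) *
      (c * supExp m (path (Wc i) ω))}.Finite := fun m c => by
    have hv : Measurable fun f : Space d → ℝ => (c : ℝ≥0∞) * supExp m f :=
      (measurable_supExp m).const_mul _
    refine (hS.isMarkedSequence hv).ae_finite_one_lt ?_
    rw [lintegral_map_path hW.isRandomField hv]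
    have := lintegral_supExp_ne_top hW.isRandomField hW.continuous_paths hW.gaussian hW.centred m
    rw [lintegral_const_mul' _ _ (ENNReal.natCast_ne_top c)]
    exact ENNReal.mul_ne_top (ENNReal.natCast_ne_top c) this
  filter_upwards [ae_all_iff.2 fun m => ae_all_iff.2 (hfin m), ae_all_iff.2 hS.continuous_paths]
    with ω hω hcont t
  obtain ⟨m, hm⟩ := exists_nat_gt ‖t‖
  -- With this `c`, a term beating the one of index `0` at `t` forces its marked point above the
  -- threshold `1`. Only finitely many do, and the maximum is then taken over these and index `0`.
  obtain ⟨c, hc⟩ := exists_nat_ge (Real.exp (-term W P₀ Wc X 0 t ω))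
  have hB : {i | term W P₀ Wc X 0 t ω < term W P₀ Wc X i t ω}.Finite := by
    refine (hω m c).subset fun i hi => ?_
    have hi' : term W P₀ Wc X 0 t ω < X i ω + path (Wc i) ω t := by
      refine lt_of_lt_of_le (Set.mem_ofPred.1 hi) ?_
      simp only [term, path]
      linarith [variance_nonneg (W t) P₀]
    rw [Set.mem_ofPred_eq]
    calc (1 : ℝ≥0∞) < ENNReal.ofReal (Real.exp (X i ω) *
          (Real.exp (-term W P₀ Wc X 0 t ω) * Real.exp (path (Wc i) ω t))) := by
          rw [ENNReal.one_lt_ofReal, ← Real.exp_add, ← Real.exp_add, Real.one_lt_exp_iff]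
          linarith
      _ = ENNReal.ofReal (Real.exp (X i ω)) * (ENNReal.ofReal (Real.exp (-term W P₀ Wc X 0 t ω)) *
          ENNReal.ofReal (Real.exp (path (Wc i) ω t))) := by
          rw [ENNReal.ofReal_mul (Real.exp_pos _).le, ENNReal.ofReal_mul (Real.exp_pos _).le]
      _ ≤ _ := by
          gcongr
          · exact ENNReal.ofReal_le_of_le_toReal (by simpa using hc)
          · exact exp_le_supExp (hcont i) hm
  obtain ⟨k, -, hk⟩ := Set.exists_max_image _ (fun i => term W P₀ Wc X i t ω)
    (hB.insert 0) (Set.insert_nonempty 0 _)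
  have hmax : IsGreatest (Set.range fun i => term W P₀ Wc X i t ω) (term W P₀ Wc X k t ω) := by
    refine ⟨⟨k, rfl⟩, ?_⟩
    rintro _ ⟨j, rfl⟩
    by_cases hj : term W P₀ Wc X 0 t ω < term W P₀ Wc X j t ω
    · exact hk j (Set.mem_insert_of_mem _ hj)
    · exact (not_lt.1 hj).trans (hk 0 (Set.mem_insert _ _))
  rwa [maxField, iSup, hmax.csSup_eq]

variable {ι : Type*} [Fintype ι]

/-- The finite-dimensional distribution functions of the field `Z`. -/
theorem measure_forall_maxField_le (hW : IsDrivingField W P₀ γ)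
    (hS : IsMarkedPoissonSample W P₀ Wc X P) (x : ι → Space d) (y : ι → ℝ) :
    P {ω | ∀ k, maxField W P₀ Wc X (x k) ω ≤ y k} = expNeg (exponent W P₀ x y) := by
  set v : (Space d → ℝ) → ℝ≥0∞ := fun f => Finset.univ.sup fun k =>
    ENNReal.ofReal (Real.exp (f (x k) - Var[W (x k); P₀] / 2 - y k))
  have hv : Measurable v := measurable_finsetSup _ fun k => by fun_prop
  have key := (hS.isMarkedSequence hv).measure_forall_le_one
  rw [lintegral_map_path hW.isRandomField hv] at key
  refine Eq.trans (measure_congr ?_) key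
  -- Attainment is needed here: a real `⨆` over an unbounded family is `0`, and then being at most
  -- `y k` would say nothing about the terms.
  filter_upwards [ae_isGreatest hW hS] with ω hω
  refine propext ?_
  change (∀ k, maxField W P₀ Wc X (x k) ω ≤ y k) ↔
    ∀ i, ENNReal.ofReal (Real.exp (X i ω)) * v (path (Wc i) ω) ≤ 1
  have h1 : ∀ k, maxField W P₀ Wc X (x k) ω ≤ y k ↔ ∀ i, term W P₀ Wc X i (x k) ω ≤ y k :=
    fun k => by
      rw [isLUB_le_iff (hω (x k)).isLUB, mem_upperBounds, Set.forall_mem_range]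
  simp_rw [h1]
  rw [forall_comm]
  refine forall_congr' fun i => ?_
  simp only [v, Finset.sup_eq_iSup, ENNReal.mul_iSup, iSup_le_iff, Finset.mem_univ, true_imp_iff]
  refine forall_congr' fun k => ?_
  rw [← ENNReal.ofReal_mul (Real.exp_pos _).le, ENNReal.ofReal_le_one, ← Real.exp_add,
    Real.exp_le_one_iff, term, path]
  constructor <;> intro h <;> linarith

theorem measure_forall_mem_maxField_le (hW : IsDrivingField W P₀ γ)
    (hS : IsMarkedPoissonSample W P₀ Wc X P) (I : Finset (Space d)) (y : Space d → ℝ)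
    (τ : Space d → Space d) :
    P {ω | ∀ t ∈ I, maxField W P₀ Wc X (τ t) ω ≤ y t} =
      expNeg (exponent W P₀ (fun t : I => τ t) fun t => y t) := by
  rw [← hS.measure_forall_maxField_le hW]
  congr 1
  ext ω
  simp

theorem isStationary_maxField (hW : IsDrivingField W P₀ γ)
    (hS : IsMarkedPoissonSample W P₀ Wc X P) : IsStationary (maxField W P₀ Wc X) P := by
  intro n x h B hB
  have hlaw : IdentDistrib (path fun t => maxField W P₀ Wc X (t + h)) (path (maxField W P₀ Wc X))
      P P := by
    refine identDistrib_of_forall_le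
      (measurable_pi_lambda _ fun t => hS.isRandomField_maxField (t + h)).aemeasurable
      hS.isRandomField_maxField.measurable_path.aemeasurable fun I y => ?_
    rw [hS.measure_forall_mem_maxField_le hW I y fun t => t + h,
      hS.measure_forall_mem_maxField_le hW I y fun t => t, hW.exponent_eq hW]
    simp
  have hmeas : MeasurableSet {f : Space d → ℝ | ∀ k, f (x k) ∈ B k} := by
    have : {f : Space d → ℝ | ∀ k, f (x k) ∈ B k} = ⋂ k, (fun f => f (x k)) ⁻¹' B k := by
      ext f
      simp
    rw [this]
    exact MeasurableSet.iInter fun k => measurable_pi_apply (x k) (hB k)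
  exact hlaw.measure_mem_eq hmeas

theorem hasStandardGumbelMargins_maxField (hW : IsDrivingField W P₀ γ)
    (hS : IsMarkedPoissonSample W P₀ Wc X P) :
    HasStandardGumbelMargins (maxField W P₀ Wc X) P := by
  intro t x
  have h := hS.measure_forall_maxField_le hW (fun _ : Unit => t) fun _ => x
  have he : exponent W P₀ (fun _ : Unit => t) (fun _ => x) = ENNReal.ofReal (Real.exp (-x)) := by
    rw [← hW.lintegral_exp_drifted_sub t x]
    simp [exponent]
  rw [he, expNeg_ofReal (Real.exp_pos _).le] at h
  simpa using h

/-- Independence raises the distribution function at `y + log n` to the power `n`, multiplying the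
exponent by `n`; homogeneity absorbs this factor into the shift. -/
theorem isMaxStable_maxField (hW : IsDrivingField W P₀ γ)
    (hS : IsMarkedPoissonSample W P₀ Wc X P) : IsMaxStable (maxField W P₀ Wc X) P := by
  refine ⟨hS.hasStandardGumbelMargins_maxField hW, ?_⟩
  intro Ω' _ P' _ n Zc hn hid hind
  have : Nonempty (Fin n) := ⟨⟨0, hn⟩⟩
  have hmax : Measurable fun (w : Fin n → Space d → ℝ) t => (⨆ l, w l t) - Real.log n :=
    measurable_pi_lambda _ fun t => (Measurable.iSup fun l =>
      (measurable_pi_apply t).comp (measurable_pi_apply l)).sub_const _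
  have hae : AEMeasurable (fun ω l => path (Zc l) ω) P' :=
    aemeasurable_pi_lambda _ fun l => (hid l).aemeasurable_fst
  refine identDistrib_of_forall_le (hmax.comp_aemeasurable hae)
    hS.isRandomField_maxField.measurable_path.aemeasurable fun I y => ?_
  have hset : {ω | ∀ t ∈ I, (⨆ l, Zc l t ω) - Real.log n ≤ y t} =
      ⋂ l ∈ Finset.univ, path (Zc l) ⁻¹' {f | ∀ t ∈ I, f t ≤ y t + Real.log n} := by
    ext ω
    simp only [Set.mem_ofPred_eq, Finset.mem_univ, Set.iInter_true, Set.mem_iInter,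
      Set.mem_preimage, path, sub_le_iff_le_add, ciSup_le_iff (Set.finite_range _).bddAbove]
    exact ⟨fun h l t ht => h t ht l, fun h t ht l => h l t ht⟩
  rw [hset, hind.measure_inter_preimage_eq_mul _ fun l _ => measurableSet_forall_le I _]
  have hl : ∀ l, P' (path (Zc l) ⁻¹' {f | ∀ t ∈ I, f t ≤ y t + Real.log n}) =
      expNeg (exponent W P₀ (fun t : I => (t : Space d)) fun t => y t + Real.log n) := fun l => by
    rw [(hid l).measure_mem_eq (measurableSet_forall_le I _)]
    exact hS.measure_forall_mem_maxField_le hW I (fun t => y t + Real.log n) fun t => t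
  simp_rw [hl]
  rw [Finset.prod_const, Finset.card_univ, Fintype.card_fin, ← expNeg_nsmul,
    IsDrivingField.natCast_mul_exponent_add_log _ _ hn]
  exact (hS.measure_forall_mem_maxField_le hW I y fun t => t).symm

/-- The law of the field `Z` depends only on the variogram. -/
theorem identDistrib_maxField {Ω₁ Ω' : Type*} [MeasurableSpace Ω₁] {P₁ : Measure Ω₁}
    [MeasurableSpace Ω'] {P' : Measure Ω'} [IsProbabilityMeasure P'] {W' : Space d → Ω₁ → ℝ}
    {Wc' : ℕ → Space d → Ω' → ℝ} {X' : ℕ → Ω' → ℝ} (hW : IsDrivingField W P₀ γ)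
    (hS : IsMarkedPoissonSample W P₀ Wc X P) (hW' : IsDrivingField W' P₁ γ)
    (hS' : IsMarkedPoissonSample W' P₁ Wc' X' P') :
    IdentDistrib (path (maxField W P₀ Wc X)) (path (maxField W' P₁ Wc' X')) P P' := by
  refine identDistrib_of_forall_le hS.isRandomField_maxField.measurable_path.aemeasurable
    hS'.isRandomField_maxField.measurable_path.aemeasurable fun I y => ?_
  rw [hS.measure_forall_mem_maxField_le hW I y fun t => t,
    hS'.measure_forall_mem_maxField_le hW' I y fun t => t,
    hW.exponent_eq hW' fun _ _ => rfl]

end IsMarkedPoissonSample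

end MaxField

end BrownResnick

/-- The field `Z` is almost surely well defined as a maximum (simultaneously at all `t`), it is a
stationary max-stable random field with standard Gumbel margins, and its law depends only on `γ`:
any other choice of all the data with the same `γ` leads to the same law. -/
theorem mainTheorem1 (d : ℕ) (γ : BrownResnick.Space d → ℝ)
    {Ω₀ : Type*} [MeasurableSpace Ω₀] (P₀ : Measure Ω₀) [IsProbabilityMeasure P₀]
    {Ω : Type*} [MeasurableSpace Ω] (P : Measure Ω) [IsProbabilityMeasure P]
    (W : BrownResnick.Space d → Ω₀ → ℝ) (Wc : ℕ → BrownResnick.Space d → Ω → ℝ)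
    (X : ℕ → Ω → ℝ)
    (hW : BrownResnick.IsDrivingField W P₀ γ)
    (hS : BrownResnick.IsMarkedPoissonSample W P₀ Wc X P) :
    (∀ᵐ ω ∂P, ∀ t, IsGreatest (Set.range fun i => BrownResnick.term W P₀ Wc X i t ω)
      (BrownResnick.maxField W P₀ Wc X t ω)) ∧
    BrownResnick.IsRandomField (BrownResnick.maxField W P₀ Wc X) ∧
    BrownResnick.IsStationary (BrownResnick.maxField W P₀ Wc X) P ∧
    BrownResnick.HasStandardGumbelMargins (BrownResnick.maxField W P₀ Wc X) P ∧
    BrownResnick.IsMaxStable (BrownResnick.maxField W P₀ Wc X) P ∧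
    (∀ {Ω₀' : Type*} [MeasurableSpace Ω₀'] (P₀' : Measure Ω₀') [IsProbabilityMeasure P₀']
      {Ω' : Type*} [MeasurableSpace Ω'] (P' : Measure Ω') [IsProbabilityMeasure P']
      (W' : BrownResnick.Space d → Ω₀' → ℝ) (Wc' : ℕ → BrownResnick.Space d → Ω' → ℝ)
      (X' : ℕ → Ω' → ℝ),
      BrownResnick.IsDrivingField W' P₀' γ →
      BrownResnick.IsMarkedPoissonSample W' P₀' Wc' X' P' →
        IdentDistrib (BrownResnick.path (BrownResnick.maxField W P₀ Wc X))
          (BrownResnick.path (BrownResnick.maxField W' P₀' Wc' X')) P P') := by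
  refine ⟨hS.ae_isGreatest hW, hS.isRandomField_maxField, hS.isStationary_maxField hW,
    hS.hasStandardGumbelMargins_maxField hW, hS.isMaxStable_maxField hW, ?_⟩
  intro _ _ _ _ _ _ _ _ _ _ _ hW' hS'
  exact hS.identDistrib_maxField hW hW' hS'
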